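/- Let $X$ be an AM-algebra, that is: $X$ is a Banach lattice algebra (a real, associative, not necessarily unital Banach algebra with submultiplicative norm which is also a Banach lattice and in which products of positive elements are positive) such that there is a net $(e_\alpha)$ of positive elements of $X$ with $x^*(e_\alpha)\to\|x^*\|$ for every positive functional $x^*\in X^*$, and with $e_\alpha a\to a$ and $ae_\alpha\to a$ in norm for every $a\in X$. Let $x\in X$ with $x\ge 0$, and let $n\ge 1$ be an integer. Then there is a unique $y\in X$ with $y\ge 0$ and $y^n=x$; denote it by $x^{1/n}$. For every lattice homomorphism $x^*\colon X\to\mathbb R$ in the closed unit ball of $X^*$ it satisfies $$x^*(x^{1/n})=\|x^*\|^{1-1/n}\,x^*(x)^{1/n}$$ (with the convention $0^0=1$). Moreover, $\|x^{1/n}\|=\|x\|^{1/n}$. -/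

import Mathlib

open Filter Topology

/-- A (real) Banach lattice algebra: a real associative algebra, not assumed unital or commutative,
with a complete submultiplicative norm, which is at the same time a vector lattice, whose norm is a
lattice norm (`|x| ≤ |y|` implies `‖x‖ ≤ ‖y‖`), and in which products of positive elements are
positive. Submultiplicativity and associativity are part of `NonUnitalNormedRing`; the bilinearity
of the product over `ℝ` is expressed by `IsScalarTower` and `SMulCommClass`. -/
class IsBanachLatticeAlgebra (A : Type*) [NonUnitalNormedRing A] [NormedSpace ℝ A] [Lattice A] :
    Prop extends IsOrderedAddMonoid A, IsOrderedModule ℝ A, HasSolidNorm A, CompleteSpace A,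
      IsScalarTower ℝ A A, SMulCommClass ℝ A A where
  /-- The product of positive elements is positive. -/
  mul_nonneg' : ∀ a b : A, 0 ≤ a → 0 ≤ b → 0 ≤ a * b

/-- The net `e` consists of positive elements and is an approximate order unit: `φ (e i) → ‖φ‖`
for every positive functional `φ` in the norm dual. -/
structure IsApproxOrderUnit {A ι : Type*} [NonUnitalNormedRing A] [NormedSpace ℝ A] [Lattice A]
    [Preorder ι] (e : ι → A) : Prop where
  nonneg : ∀ i, 0 ≤ e i
  tendsto_norm : ∀ φ : StrongDual ℝ A, (∀ a : A, 0 ≤ a → 0 ≤ φ a) →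
    Tendsto (fun i => φ (e i)) atTop (𝓝 ‖φ‖)

/-- The net `e` is a (two-sided, norm) approximate algebraic identity. -/
structure IsApproxIdentity {A ι : Type*} [NonUnitalNormedRing A] [Preorder ι] (e : ι → A) :
    Prop where
  tendsto_mul_left : ∀ a : A, Tendsto (fun i => e i * a) atTop (𝓝 a)
  tendsto_mul_right : ∀ a : A, Tendsto (fun i => a * e i) atTop (𝓝 a)

/-- The Banach lattice algebra `A`, with its given product, is an AM-algebra with approximate
unit the net `e`. -/
structure IsAMAlgebraWithApproxUnit {A ι : Type*} [NonUnitalNormedRing A] [NormedSpace ℝ A]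
    [Lattice A] [Preorder ι] (e : ι → A) : Prop where
  isBanachLatticeAlgebra : IsBanachLatticeAlgebra A
  isApproxOrderUnit : IsApproxOrderUnit e
  isApproxIdentity : IsApproxIdentity e

/-- The set `K_A` of all lattice homomorphisms `A → ℝ` in the closed unit ball of the dual. -/
def latticeHomBall (A : Type*) [NonUnitalNormedRing A] [NormedSpace ℝ A] [Lattice A] :
    Set (StrongDual ℝ A) :=
  {φ | (∀ a b : A, φ (a ⊔ b) = φ a ⊔ φ b) ∧ (∀ a b : A, φ (a ⊓ b) = φ a ⊓ φ b) ∧ ‖φ‖ ≤ 1}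

/-- The `n`-th power `a * ⋯ * a` (`n ≥ 1` factors) in an algebra that need not have a unit. The
value at `n = 0` is a convention that is never used. -/
def algPow {A : Type*} [NonUnitalNormedRing A] (a : A) : ℕ → A
  | 0 => 0
  | 1 => a
  | n + 2 => algPow a (n + 1) * a

/-- `y` is a positive `n`-th root of `x` (for `n ≥ 1`). -/
def IsPositiveRoot {A : Type*} [NonUnitalNormedRing A] [Lattice A] (n : ℕ) (x y : A) : Prop :=
  0 ≤ y ∧ algPow y n = x

/-! Along the net `e`, a positive functional tends to its norm. Hence norms of positive functionals
add, and for positive `f`, `c` the functional `a ↦ f (a * c)` has norm `f c`; so multiplication by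
`b` is dominated by `‖b‖`. By additivity, extreme points of the positive dual ball are
multiplicative, and Krein–Milman makes these characters norm `X`, as in `C₀(K)`. Roots are therefore
computed pointwise: uniqueness is injectivity of `t ↦ t ^ n` on `[0, ∞)`, existence is Weierstrass
approximation, and `‖y ^ n‖ = ‖y‖ ^ n` is seen at a norming character. A lattice homomorphism
satisfies `‖φ‖ φ(ab) = φ(a) φ(b)` for `a ≥ 0`; iterating and taking roots gives the formula. -/

theorem norm_algPow_le {A : Type*} [NonUnitalNormedRing A] (a : A) :
    ∀ n : ℕ, n ≠ 0 → ‖algPow a n‖ ≤ ‖a‖ ^ n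
  | 0, h => absurd rfl h
  | 1, _ => by rw [pow_one]; rfl
  | n + 2, _ => by
    rw [algPow, pow_succ]
    exact (norm_mul_le _ _).trans
      (mul_le_mul_of_nonneg_right (norm_algPow_le a (n + 1) n.succ_ne_zero) (norm_nonneg a))

/-! ### Positive functionals and domination of products -/

section PositiveFunctionals

variable {X : Type*} [NonUnitalNormedRing X] [NormedSpace ℝ X] [Lattice X]

/-- Every `a` in a Banach lattice is sent to `‖a⁺‖` by some positive functional in the dual ball. -/
theorem exists_positive_functional_eq_norm_posPart [IsBanachLatticeAlgebra X] (a : X) :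
    ∃ f : StrongDual ℝ X, (∀ b, 0 ≤ b → 0 ≤ f b) ∧ ‖f‖ ≤ 1 ∧ f a = ‖a⁺‖ := by
  have hsub : ∀ b c : X, ‖(b + c)⁺‖ ≤ ‖b⁺‖ + ‖c⁺‖ := by
    intro b c
    refine le_trans (norm_le_norm_of_abs_le_abs ?_) (norm_add_le _ _)
    rw [abs_of_nonneg (posPart_nonneg _),
      abs_of_nonneg (add_nonneg (posPart_nonneg b) (posPart_nonneg c))]
    exact sup_le (add_le_add (le_posPart b) (le_posPart c))
      (add_nonneg (posPart_nonneg b) (posPart_nonneg c))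
  have hhom : ∀ t : ℝ, 0 < t → ∀ b : X, ‖(t • b)⁺‖ = t * ‖b⁺‖ := by
    intro t ht b
    have h : (t • b)⁺ = t • b⁺ := by
      rw [posPart_def, posPart_def]
      have h := (OrderIso.smulRight (β := X) ht).map_sup b 0
      simp only [OrderIso.smulRight_apply, smul_zero] at h
      exact h.symm
    rw [h, norm_smul, Real.norm_of_nonneg ht.le]
  -- Hahn–Banach under the sublinear `b ↦ ‖b⁺‖`; this bound forces positivity, since `(-b)⁺ = 0` for
  -- `b ≥ 0`.
  obtain ⟨g, hga, hg⟩ : ∃ g : X →ₗ[ℝ] ℝ, g a = ‖a⁺‖ ∧ ∀ b, g b ≤ ‖b⁺‖ := by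
    rcases eq_or_ne a 0 with rfl | ha
    · exact ⟨0, by simp, fun b => norm_nonneg _⟩
    let p : X →ₗ.[ℝ] ℝ := LinearPMap.mkSpanSingleton a ‖a⁺‖ ha
    have hdom : ∀ b : p.domain,
        p b ≤ ‖(b : X)⁺‖ := by
      rintro ⟨b, hb⟩
      obtain ⟨t, rfl⟩ := Submodule.mem_span_singleton.1 hb
      rw [LinearPMap.mkSpanSingleton'_apply, smul_eq_mul]
      rcases le_or_gt t 0 with ht | ht
      · exact (mul_nonpos_of_nonpos_of_nonneg ht (norm_nonneg _)).trans (norm_nonneg _)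
      · exact (hhom t ht a).ge
    obtain ⟨g, h1, h2⟩ := exists_extension_of_le_sublinear p (fun b => ‖b⁺‖) hhom hsub hdom
    refine ⟨g, ?_, h2⟩
    have h := h1 ⟨a, Submodule.mem_span_singleton_self a⟩
    rwa [LinearPMap.mkSpanSingleton_apply] at h
  have hpos : ∀ b, 0 ≤ b → 0 ≤ g b := fun b hb => by
    have h := hg (-b)
    rw [posPart_of_nonpos (neg_nonpos.2 hb), norm_zero, map_neg] at h
    linarith
  have hle : ∀ b, g b ≤ ‖b‖ := fun b => (hg b).trans <| norm_le_norm_of_abs_le_abs <| by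
    rw [abs_of_nonneg (posPart_nonneg b)]
    exact sup_le (le_abs_self b) (abs_nonneg b)
  have hbound : ∀ b, ‖g b‖ ≤ 1 * ‖b‖ := fun b => by
    rw [one_mul, Real.norm_eq_abs, abs_le']
    exact ⟨hle b, by simpa using hle (-b)⟩
  exact ⟨g.mkContinuous 1 hbound, hpos, g.mkContinuous_norm_le zero_le_one hbound, hga⟩

/-- Multiplication by `b ≥ 0` is dominated by `‖b‖` under positive functionals. -/
theorem IsAMAlgebraWithApproxUnit.map_mul_le {ι : Type*} [Preorder ι] [IsDirectedOrder ι]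
    [Nonempty ι] {e : ι → X} (hX : IsAMAlgebraWithApproxUnit e) (f : StrongDual ℝ X)
    (hf : ∀ b, 0 ≤ b → 0 ≤ f b) {b c : X} (hc : 0 ≤ c) :
    f (b * c) ≤ ‖b‖ * f c ∧ f (c * b) ≤ ‖b‖ * f c := by
  have := hX.isBanachLatticeAlgebra
  constructor
  · let g : StrongDual ℝ X := f.comp ((ContinuousLinearMap.mul ℝ X).flip c)
    have hg : ∀ a, g a = f (a * c) := fun a => rfl
    -- The values `f (e i * c)` tend both to `‖g‖` and to `f c`.
    have h1 := hX.isApproxOrderUnit.tendsto_norm g fun a ha =>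
      hf _ (IsBanachLatticeAlgebra.mul_nonneg' _ _ ha hc)
    have h2 := (f.continuous.tendsto c).comp (hX.isApproxIdentity.tendsto_mul_left c)
    have h3 : ‖g‖ = f c := tendsto_nhds_unique h1 h2
    have h4 := (le_abs_self _).trans (g.le_opNorm b)
    rw [h3, hg] at h4
    linarith
  · let g : StrongDual ℝ X := f.comp (ContinuousLinearMap.mul ℝ X c)
    have hg : ∀ a, g a = f (c * a) := fun a => rfl
    have h1 := hX.isApproxOrderUnit.tendsto_norm g fun a ha =>
      hf _ (IsBanachLatticeAlgebra.mul_nonneg' _ _ hc ha)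
    have h2 := (f.continuous.tendsto c).comp (hX.isApproxIdentity.tendsto_mul_right c)
    have h3 : ‖g‖ = f c := tendsto_nhds_unique h1 h2
    have h4 := (le_abs_self _).trans (g.le_opNorm b)
    rw [h3, hg] at h4
    linarith

theorem le_of_forall_positive_functional [IsBanachLatticeAlgebra X] {a b : X}
    (h : ∀ f : StrongDual ℝ X, (∀ c, 0 ≤ c → 0 ≤ f c) → f a ≤ f b) : a ≤ b := by
  obtain ⟨f, hf, -, hfa⟩ := exists_positive_functional_eq_norm_posPart (a - b)
  have h1 := h f hf
  rw [map_sub] at hfa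
  have h2 : ‖(a - b)⁺‖ = 0 := le_antisymm (by linarith) (norm_nonneg _)
  rw [norm_eq_zero, posPart_eq_zero] at h2
  exact sub_nonpos.1 h2

/-! ### Products of disjoint elements -/

section AMAlgebra

variable {ι : Type*} [Preorder ι] [IsDirectedOrder ι] [Nonempty ι] {e : ι → X}

/-- A product of positive elements lies below a multiple of each factor, hence below a multiple of
their infimum. -/
theorem IsAMAlgebraWithApproxUnit.posPart_mul_negPart (hX : IsAMAlgebraWithApproxUnit e) (a : X) :
    a⁺ * a⁻ = 0 ∧ a⁻ * a⁺ = 0 := by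
  have := hX.isBanachLatticeAlgebra
  have key : ∀ b c : X, 0 ≤ b → 0 ≤ c → b ⊓ c = 0 → b * c = 0 := by
    intro b c hb hc hbc
    have hM : 0 < ‖b‖ + ‖c‖ + 1 := by positivity
    have h1 : b * c ≤ (‖b‖ + ‖c‖ + 1) • c := le_of_forall_positive_functional fun f hf => by
      have := (hX.map_mul_le f hf (b := b) hc).1
      rw [map_smul, smul_eq_mul]
      nlinarith [hf c hc, norm_nonneg c]
    have h2 : b * c ≤ (‖b‖ + ‖c‖ + 1) • b := le_of_forall_positive_functional fun f hf => by
      have := (hX.map_mul_le f hf (b := c) hb).2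
      rw [map_smul, smul_eq_mul]
      nlinarith [hf b hb, norm_nonneg b]
    have h3 : (‖b‖ + ‖c‖ + 1)⁻¹ • (b * c) ≤ b ⊓ c :=
      le_inf ((inv_smul_le_iff_of_pos hM).2 h2) ((inv_smul_le_iff_of_pos hM).2 h1)
    rw [hbc, inv_smul_le_iff_of_pos hM, smul_zero] at h3
    exact le_antisymm h3 (IsBanachLatticeAlgebra.mul_nonneg' _ _ hb hc)
  have hd : a⁺ ⊓ a⁻ = 0 := posPart_inf_negPart_eq_zero a
  exact ⟨key _ _ (posPart_nonneg a) (negPart_nonneg a) hd,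
    key _ _ (negPart_nonneg a) (posPart_nonneg a) (inf_comm a⁺ a⁻ ▸ hd)⟩

theorem IsAMAlgebraWithApproxUnit.abs_mul_abs_self (hX : IsAMAlgebraWithApproxUnit e) (a : X) :
    |a| * |a| = a * a := by
  have := hX.isBanachLatticeAlgebra
  obtain ⟨h1, h2⟩ := hX.posPart_mul_negPart a
  rw [← posPart_add_negPart a]
  conv_rhs => rw [← posPart_sub_negPart a]
  simp only [add_mul, mul_add, sub_mul, mul_sub, h1, h2]
  abel

/-! ### Characters from extreme points -/

/-- The positive part of the closed unit ball of the dual. -/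
def positiveDualBall (X : Type*) [NonUnitalNormedRing X] [NormedSpace ℝ X] [Lattice X] :
    Set (WeakDual ℝ X) :=
  {f | (∀ a : X, 0 ≤ a → 0 ≤ f a) ∧ ‖WeakDual.toStrongDual f‖ ≤ 1}

theorem isCompact_positiveDualBall : IsCompact (positiveDualBall X) := by
  have h : positiveDualBall X = (WeakDual.toStrongDual ⁻¹' Metric.closedBall 0 1) ∩
      ⋂ a ∈ {a : X | 0 ≤ a}, {f : WeakDual ℝ X | 0 ≤ f a} := by
    ext f
    simp [positiveDualBall, and_comm]
  rw [h]
  exact (WeakDual.isCompact_closedBall 0 1).inter_right <|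
    isClosed_biInter fun a _ => isClosed_le continuous_const (WeakDual.eval_continuous a)

/-- Extreme points of the positive dual ball are multiplicative. -/
theorem IsAMAlgebraWithApproxUnit.map_mul_of_mem_extremePoints
    (hX : IsAMAlgebraWithApproxUnit e) {f : WeakDual ℝ X}
    (hf : f ∈ (positiveDualBall X).extremePoints ℝ) (a c : X) : f (a * c) = f a * f c := by
  have := hX.isBanachLatticeAlgebra
  obtain ⟨⟨hpos, hnorm⟩, hext⟩ := hf
  set F : StrongDual ℝ X := WeakDual.toStrongDual f with hF
  have hposF : ∀ a, 0 ≤ a → 0 ≤ F a := hpos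
  have key : ∀ a : X, 0 ≤ a → ‖a‖ ≤ 1 → ∀ c, F (a * c) = F a * F c := by
    intro a ha ha1 c
    let G : StrongDual ℝ X := F.comp (ContinuousLinearMap.mul ℝ X a)
    have hGpos : ∀ b, 0 ≤ b → 0 ≤ G b := fun b hb =>
      hposF _ (IsBanachLatticeAlgebra.mul_nonneg' _ _ ha hb)
    have hFGpos : ∀ b, 0 ≤ b → 0 ≤ (F - G) b := fun b hb => by
      have h := (hX.map_mul_le F hposF (b := a) hb).1
      have h' : (F - G) b = F b - F (a * b) := rfl
      rw [h']
      nlinarith [hposF b hb]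
    have hlim : Tendsto (fun i => G (e i)) atTop (𝓝 (F a)) :=
      (F.continuous.tendsto a).comp (hX.isApproxIdentity.tendsto_mul_right a)
    have hGn : ‖G‖ = F a :=
      tendsto_nhds_unique (hX.isApproxOrderUnit.tendsto_norm G hGpos) hlim
    -- Additivity of the norm: `‖F‖ = ‖G‖ + ‖F - G‖`.
    have hFGn : ‖F - G‖ = ‖F‖ - F a :=
      tendsto_nhds_unique (hX.isApproxOrderUnit.tendsto_norm (F - G) hFGpos)
        ((hX.isApproxOrderUnit.tendsto_norm F hposF).sub hlim)
    have hG : G = F a • F := by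
      -- If `F a` is `0` or `1`, then `G` or `F - G` vanishes. Otherwise `F` is the convex
      -- combination of the normalized `G` and `F - G` with weights `F a` and `1 - F a`.
      rcases (hposF a ha).eq_or_lt with h0 | h0
      · rw [← h0, zero_smul, ← norm_eq_zero, hGn, ← h0]
      have hle : F a ≤ 1 := by linarith [norm_nonneg (F - G)]
      rcases hle.eq_or_lt with h1 | h1
      · have : ‖F - G‖ = 0 := le_antisymm (by linarith) (norm_nonneg _)
        rw [h1, one_smul, ← sub_eq_zero.1 (norm_eq_zero.1 this)]
      have h1' : 0 < 1 - F a := by linarith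
      have m1 : (StrongDual.toWeakDual ((F a)⁻¹ • G)) ∈ positiveDualBall X := by
        refine ⟨fun b hb => mul_nonneg (inv_nonneg.2 h0.le) (hGpos b hb), ?_⟩
        change ‖(F a)⁻¹ • G‖ ≤ 1
        rw [norm_smul, hGn, Real.norm_of_nonneg (inv_nonneg.2 h0.le), inv_mul_cancel₀ h0.ne']
      have m2 : (StrongDual.toWeakDual ((1 - F a)⁻¹ • (F - G))) ∈ positiveDualBall X := by
        refine ⟨fun b hb => mul_nonneg (inv_nonneg.2 h1'.le) (hFGpos b hb), ?_⟩
        change ‖(1 - F a)⁻¹ • (F - G)‖ ≤ 1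
        rw [norm_smul, hFGn, Real.norm_of_nonneg (inv_nonneg.2 h1'.le),
          inv_mul_le_iff₀ h1']
        linarith
      have h := hext m1 m2 ⟨F a, 1 - F a, h0, h1', by ring, by
        change F a • ((F a)⁻¹ • G) + (1 - F a) • ((1 - F a)⁻¹ • (F - G)) = F
        rw [smul_inv_smul₀ h0.ne', smul_inv_smul₀ h1'.ne', add_sub_cancel]⟩
      have h' : (F a)⁻¹ • G = F := h
      exact (inv_smul_eq_iff₀ h0.ne').1 h'
    exact congrArg (fun H : StrongDual ℝ X => H c) hG
  have key' : ∀ a : X, 0 ≤ a → ∀ c, F (a * c) = F a * F c := by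
    intro a ha c
    have hM : 0 < ‖a‖ + 1 := by positivity
    have h := key ((‖a‖ + 1)⁻¹ • a) (smul_nonneg (inv_nonneg.2 hM.le) ha) (by
      rw [norm_smul, Real.norm_of_nonneg (inv_nonneg.2 hM.le), inv_mul_le_iff₀ hM]
      linarith) c
    rw [smul_mul_assoc, map_smul, map_smul, smul_eq_mul, smul_eq_mul, mul_assoc] at h
    exact mul_left_cancel₀ (inv_ne_zero hM.ne') h
  change F (a * c) = F a * F c
  rw [← posPart_sub_negPart a, sub_mul, map_sub, map_sub, key' _ (posPart_nonneg a),
    key' _ (negPart_nonneg a), sub_mul]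

/-- The positive multiplicative functionals. -/
def positiveCharacters (X : Type*) [NonUnitalNormedRing X] [NormedSpace ℝ X] [Lattice X] :
    Set (StrongDual ℝ X) :=
  {f | (∀ a : X, 0 ≤ a → 0 ≤ f a) ∧ ‖f‖ ≤ 1 ∧ ∀ a b : X, f (a * b) = f a * f b}

/-- Both sides are nonnegative with equal squares, because `|a| * |a| = a * a`. -/
theorem IsAMAlgebraWithApproxUnit.character_abs (hX : IsAMAlgebraWithApproxUnit e)
    {f : StrongDual ℝ X} (hf : f ∈ positiveCharacters X) (a : X) : f |a| = |f a| := by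
  have := hX.isBanachLatticeAlgebra
  rw [← abs_of_nonneg (hf.1 _ (abs_nonneg a)), ← sq_eq_sq_iff_abs_eq_abs, sq, sq, ← hf.2.2,
    ← hf.2.2, hX.abs_mul_abs_self]

/-- The norm of every element is attained at some positive character. -/
theorem IsAMAlgebraWithApproxUnit.exists_character_abs_eq_norm
    (hX : IsAMAlgebraWithApproxUnit e) (a : X) :
    ∃ f ∈ positiveCharacters X, |f a| = ‖a‖ := by
  have := hX.isBanachLatticeAlgebra
  obtain ⟨g, hg, hg1, hga⟩ := exists_positive_functional_eq_norm_posPart |a|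
  rw [posPart_of_nonneg (abs_nonneg a), norm_abs_eq_norm] at hga
  let ev : StrongDual ℝ (WeakDual ℝ X) :=
    { toFun := fun f => f |a|
      map_add' := fun _ _ => rfl
      map_smul' := fun _ _ => rfl
      cont := WeakDual.eval_continuous |a| }
  have hgQ : StrongDual.toWeakDual g ∈ positiveDualBall X := ⟨hg, hg1⟩
  -- The maximizers of `f ↦ f |a|` form an exposed face, whose extreme points are extreme in the
  -- whole ball.
  have hexp : IsExposed ℝ (positiveDualBall X) (ev.toExposed (positiveDualBall X)) :=
    ContinuousLinearMap.toExposed.isExposed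
  have : LocallyConvexSpace ℝ (WeakDual ℝ X) :=
    inferInstanceAs (LocallyConvexSpace ℝ (WeakBilin (topDualPairing ℝ X)))
  obtain ⟨m, hm, hmax⟩ := isCompact_positiveDualBall.exists_isMaxOn ⟨_, hgQ⟩
    ev.continuous.continuousOn
  obtain ⟨f, hf⟩ := (hexp.isCompact isCompact_positiveDualBall).extremePoints_nonempty
    ⟨m, hm, fun y hy => hmax hy⟩
  have hfe := hexp.isExtreme.extremePoints_subset_extremePoints hf
  have hfc : WeakDual.toStrongDual f ∈ positiveCharacters X :=
    ⟨hfe.1.1, hfe.1.2, hX.map_mul_of_mem_extremePoints hfe⟩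
  refine ⟨_, hfc, ?_⟩
  rw [← hX.character_abs hfc]
  apply le_antisymm
  · have h := (le_abs_self _).trans ((WeakDual.toStrongDual f).le_of_opNorm_le hfe.1.2 |a|)
    rwa [one_mul, norm_abs_eq_norm] at h
  · rw [← hga]
    exact hf.1.2 _ hgQ

theorem IsAMAlgebraWithApproxUnit.eq_of_forall_character (hX : IsAMAlgebraWithApproxUnit e)
    {a b : X} (h : ∀ f ∈ positiveCharacters X, f a = f b) : a = b := by
  obtain ⟨f, hf, hfa⟩ := hX.exists_character_abs_eq_norm (a - b)
  rw [map_sub, h f hf, sub_self, abs_zero] at hfa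
  exact sub_eq_zero.1 (norm_eq_zero.1 hfa.symm)

theorem map_algPow_of_mem_positiveCharacters {f : StrongDual ℝ X} (hf : f ∈ positiveCharacters X)
    (a : X) : ∀ n : ℕ, n ≠ 0 → f (algPow a n) = f a ^ n
  | 0, h => absurd rfl h
  | 1, _ => by rw [pow_one]; rfl
  | n + 2, _ => by
    rw [algPow, hf.2.2, map_algPow_of_mem_positiveCharacters hf a (n + 1) n.succ_ne_zero,
      pow_succ (f a) (n + 1)]

theorem IsAMAlgebraWithApproxUnit.norm_algPow (hX : IsAMAlgebraWithApproxUnit e) (a : X) {n : ℕ}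
    (hn : n ≠ 0) : ‖algPow a n‖ = ‖a‖ ^ n := by
  obtain ⟨f, hf, hfa⟩ := hX.exists_character_abs_eq_norm a
  refine le_antisymm (norm_algPow_le a n hn) ?_
  rw [← hfa, ← abs_pow, ← map_algPow_of_mem_positiveCharacters hf a n hn]
  simpa using f.le_of_opNorm_le hf.2.1 (algPow a n)

/-! ### Lattice homomorphisms and powers -/

/-- On an AM-algebra, a lattice homomorphism is multiplicative up to its norm. -/
theorem IsAMAlgebraWithApproxUnit.norm_mul_map_mul (hX : IsAMAlgebraWithApproxUnit e)
    {φ : StrongDual ℝ X} (hsup : ∀ a b : X, φ (a ⊔ b) = φ a ⊔ φ b) {a : X} (ha : 0 ≤ a) (c : X) :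
    ‖φ‖ * φ (a * c) = φ a * φ c := by
  have := hX.isBanachLatticeAlgebra
  have hpos : ∀ b : X, 0 ≤ b → 0 ≤ φ b := fun b hb => by
    have h := hsup b 0
    rw [sup_of_le_left hb, map_zero] at h
    exact sup_eq_left.1 h.symm
  -- The kernel absorbs products: `a * d` lies between `± a * |d|`, and domination gives `φ (a *
  -- |d|) ≤ ‖a‖ * φ |d| = 0`.
  have hker : ∀ d : X, φ d = 0 → φ (a * d) = 0 := by
    intro d hd
    have hd0 : φ |d| = 0 := by
      rw [abs, hsup, map_neg, hd, neg_zero, sup_idem]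
    have h1 : φ (a * |d|) ≤ 0 := by
      have h := (hX.map_mul_le φ hpos (b := a) (abs_nonneg d)).1
      rwa [hd0, mul_zero] at h
    have h2 : 0 ≤ φ (a * (|d| - d)) :=
      hpos _ (IsBanachLatticeAlgebra.mul_nonneg' _ _ ha (sub_nonneg.2 (le_abs_self d)))
    have h3 : 0 ≤ φ (a * (|d| + d)) :=
      hpos _ (IsBanachLatticeAlgebra.mul_nonneg' _ _ ha
        (neg_le_iff_add_nonneg.1 (neg_le_abs d)))
    rw [mul_sub, map_sub] at h2
    rw [mul_add, map_add] at h3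
    linarith
  -- Taking `b = e i`, in the limit `φ b` becomes `‖φ‖` and `φ (a * b)` becomes `φ a`.
  have hcomm : ∀ b : X, φ b * φ (a * c) = φ (a * b) * φ c := by
    intro b
    have h := hker (φ b • c - φ c • b) (by simp only [map_sub, map_smul, smul_eq_mul]; ring)
    rw [mul_sub, mul_smul_comm, mul_smul_comm, map_sub, map_smul, map_smul, smul_eq_mul,
      smul_eq_mul] at h
    linarith
  have h1 := (hX.isApproxOrderUnit.tendsto_norm φ hpos).mul_const (φ (a * c))
  have h2 := ((φ.continuous.tendsto a).comp
    (hX.isApproxIdentity.tendsto_mul_right a)).mul_const (φ c)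
  refine tendsto_nhds_unique h1 (h2.congr fun i => (hcomm (e i)).symm)

theorem IsBanachLatticeAlgebra.algPow_nonneg [IsBanachLatticeAlgebra X] {a : X} (ha : 0 ≤ a) :
    ∀ n : ℕ, 0 ≤ algPow a n
  | 0 => le_rfl
  | 1 => ha
  | n + 2 => IsBanachLatticeAlgebra.mul_nonneg' _ _ (algPow_nonneg ha (n + 1)) ha

theorem IsAMAlgebraWithApproxUnit.norm_pow_mul_map_algPow (hX : IsAMAlgebraWithApproxUnit e)
    {φ : StrongDual ℝ X} (hsup : ∀ a b : X, φ (a ⊔ b) = φ a ⊔ φ b) {a : X} (ha : 0 ≤ a) :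
    ∀ n : ℕ, ‖φ‖ ^ n * φ (algPow a (n + 1)) = φ a ^ (n + 1)
  | 0 => by simp [algPow]
  | n + 1 => by
    have := hX.isBanachLatticeAlgebra
    have h := hX.norm_mul_map_mul hsup (IsBanachLatticeAlgebra.algPow_nonneg ha (n + 1)) a
    have h' := hX.norm_pow_mul_map_algPow hsup ha n
    rw [algPow, pow_succ, mul_assoc, h, ← mul_assoc, h', pow_succ (φ a) (n + 1)]

/-! ### Functional calculus and roots -/

/-- A polynomial without constant term evaluated in an algebra that need not be unital; the
constant term is dropped. -/
noncomputable def polyEval (p : Polynomial ℝ) (a : X) : X :=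
  p.sum fun i c => c • algPow a i

theorem map_polyEval_of_mem_positiveCharacters {f : StrongDual ℝ X} (hf : f ∈ positiveCharacters X)
    (p : Polynomial ℝ) (a : X) : f (polyEval p a) = p.eval (f a) - p.eval 0 := by
  rw [polyEval, Polynomial.sum_def, map_sum, Polynomial.eval_eq_sum, Polynomial.eval_eq_sum,
    Polynomial.sum_def, Polynomial.sum_def, ← Finset.sum_sub_distrib]
  refine Finset.sum_congr rfl fun i _ => ?_
  rcases eq_or_ne i 0 with rfl | hi
  · simp [algPow]
  · rw [map_smul, map_algPow_of_mem_positiveCharacters hf a i hi, zero_pow hi]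
    simp

/-- Continuous functional calculus at a positive element, for functions vanishing at `0`. -/
theorem IsAMAlgebraWithApproxUnit.exists_forall_character_eq (hX : IsAMAlgebraWithApproxUnit e)
    {x : X} (hx : 0 ≤ x) {g : ℝ → ℝ} (hg : Continuous g) (hg0 : g 0 = 0) :
    ∃ y : X, ∀ f ∈ positiveCharacters X, f y = g (f x) := by
  have := hX.isBanachLatticeAlgebra
  have hmem : ∀ f ∈ positiveCharacters X, f x ∈ Set.Icc 0 ‖x‖ := fun f hf =>
    ⟨hf.1 x hx, (le_abs_self _).trans (by simpa using f.le_of_opNorm_le hf.2.1 x)⟩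
  have hpoly : ∀ k : ℕ, ∃ p : Polynomial ℝ, ∀ t ∈ Set.Icc 0 ‖x‖,
      |p.eval t - g t| < 1 / ((k : ℝ) + 1) := fun k =>
    exists_polynomial_near_of_continuousOn 0 ‖x‖ g hg.continuousOn _ Nat.one_div_pos_of_nat
  choose p hp using hpoly
  have hfp : ∀ k, ∀ f ∈ positiveCharacters X,
      |f (polyEval (p k) x) - g (f x)| ≤ 2 * (1 / ((k : ℝ) + 1)) := by
    intro k f hf
    have h1 := hp k _ (hmem f hf)
    -- The dropped constant term is within `1 / (k + 1)` of `g 0 = 0`, hence the factor 2.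
    have h2 := hp k 0 ⟨le_rfl, norm_nonneg x⟩
    rw [hg0, sub_zero] at h2
    rw [map_polyEval_of_mem_positiveCharacters hf, abs_le]
    rw [abs_lt] at h1 h2
    constructor <;> linarith [h1.1, h1.2, h2.1, h2.2]
  have hzero : Tendsto (fun k : ℕ => 4 * (1 / ((k : ℝ) + 1))) atTop (𝓝 0) := by
    simpa using tendsto_one_div_add_atTop_nhds_zero_nat.const_mul (4 : ℝ)
  have hcauchy : CauchySeq fun k => polyEval (p k) x := by
    refine cauchySeq_of_le_tendsto_0 _ (fun m n N hm hn => ?_) hzero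
    obtain ⟨f, hf, hfa⟩ := hX.exists_character_abs_eq_norm (polyEval (p m) x - polyEval (p n) x)
    rw [dist_eq_norm, ← hfa, map_sub, abs_le]
    have h1 := abs_le.1 (hfp m f hf)
    have h2 := abs_le.1 (hfp n f hf)
    have h3 : 1 / ((m : ℝ) + 1) ≤ 1 / ((N : ℝ) + 1) := Nat.one_div_le_one_div hm
    have h4 : 1 / ((n : ℝ) + 1) ≤ 1 / ((N : ℝ) + 1) := Nat.one_div_le_one_div hn
    constructor <;> linarith [h1.1, h1.2, h2.1, h2.2]
  obtain ⟨y, hy⟩ := cauchySeq_tendsto_of_complete hcauchy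
  refine ⟨y, fun f hf => tendsto_nhds_unique ((f.continuous.tendsto y).comp hy) ?_⟩
  rw [tendsto_iff_norm_sub_tendsto_zero]
  refine squeeze_zero (fun _ => norm_nonneg _) (fun k => (hfp k f hf).trans ?_) hzero
  have : 0 < 1 / ((k : ℝ) + 1) := Nat.one_div_pos_of_nat
  linarith

theorem IsAMAlgebraWithApproxUnit.exists_isPositiveRoot (hX : IsAMAlgebraWithApproxUnit e)
    {x : X} (hx : 0 ≤ x) {n : ℕ} (hn : n ≠ 0) : ∃ y : X, IsPositiveRoot n x y := by
  have := hX.isBanachLatticeAlgebra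
  obtain ⟨y, hy⟩ := hX.exists_forall_character_eq hx (g := fun t => t ^ ((n : ℝ)⁻¹))
    (Real.continuous_rpow_const (by positivity)) (Real.zero_rpow (by positivity))
  refine ⟨y, ?_, ?_⟩
  -- Positivity is expressed as an equation, which characters can test.
  · have h : y = |y| := hX.eq_of_forall_character fun f hf => by
      rw [hX.character_abs hf, hy f hf, abs_of_nonneg (Real.rpow_nonneg (hf.1 x hx) _)]
    rw [h]
    exact abs_nonneg y
  · refine hX.eq_of_forall_character fun f hf => ?_
    rw [map_algPow_of_mem_positiveCharacters hf y n hn, hy f hf,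
      Real.rpow_inv_natCast_pow (hf.1 x hx) hn]

theorem IsAMAlgebraWithApproxUnit.isPositiveRoot_unique (hX : IsAMAlgebraWithApproxUnit e)
    {x y z : X} {n : ℕ} (hn : n ≠ 0) (hy : IsPositiveRoot n x y) (hz : IsPositiveRoot n x z) :
    y = z := by
  refine hX.eq_of_forall_character fun f hf => ?_
  rw [← pow_left_inj₀ (hf.1 y hy.1) (hf.1 z hz.1) hn,
    ← map_algPow_of_mem_positiveCharacters hf y n hn,
    ← map_algPow_of_mem_positiveCharacters hf z n hn, hy.2, hz.2]

end AMAlgebra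

end PositiveFunctionals

theorem lemma4p1 {X ι : Type*} [NonUnitalNormedRing X] [NormedSpace ℝ X] [Lattice X]
    [Preorder ι] [IsDirectedOrder ι] [Nonempty ι] (e : ι → X)
    (hX : IsAMAlgebraWithApproxUnit e) (x : X) (hx : 0 ≤ x) (n : ℕ) (hn : 1 ≤ n) :
    (∃! y : X, IsPositiveRoot n x y) ∧
      ∀ y : X, IsPositiveRoot n x y →
        (∀ φ ∈ latticeHomBall X,
          φ y = ‖φ‖ ^ (1 - 1 / (n : ℝ)) * (φ x) ^ (1 / (n : ℝ))) ∧
        ‖y‖ = ‖x‖ ^ (1 / (n : ℝ)) := by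
  have hn0 : n ≠ 0 := by omega
  obtain ⟨y₀, hy₀⟩ := hX.exists_isPositiveRoot hx hn0
  refine ⟨⟨y₀, hy₀, fun z hz => hX.isPositiveRoot_unique hn0 hz hy₀⟩, fun y hy => ⟨?_, ?_⟩⟩
  · rintro φ ⟨hsup, -, -⟩
    have hpos : ∀ b : X, 0 ≤ b → 0 ≤ φ b := fun b hb => by
      have h := hsup b 0
      rw [sup_of_le_left hb, map_zero] at h
      exact sup_eq_left.1 h.symm
    obtain ⟨m, rfl⟩ := Nat.exists_eq_succ_of_ne_zero hn0
    have h := hX.norm_pow_mul_map_algPow hsup hy.1 m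
    rw [← Nat.succ_eq_add_one, hy.2] at h
    -- With `n = m + 1`, the right side becomes the `n`-th root of `‖φ‖ ^ m * φ x`; for `m = 0` and
    -- `φ = 0` this relies on `0 ^ 0 = 1`.
    have hexp : 1 - 1 / ((m.succ : ℕ) : ℝ) = (m : ℝ) * (1 / ((m.succ : ℕ) : ℝ)) := by
      push_cast
      field_simp
      ring
    rw [hexp, Real.rpow_mul (norm_nonneg φ), Real.rpow_natCast,
      ← Real.mul_rpow (pow_nonneg (norm_nonneg φ) m) (hpos x hx), h, one_div,
      Real.pow_rpow_inv_natCast (hpos y hy.1) hn0]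
  · rw [← hy.2, hX.norm_algPow y hn0, one_div, Real.pow_rpow_inv_natCast (norm_nonneg y) hn0]
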